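/- Let $\mathcal{M}_n$ be the algebra of complex $n\times n$ matrices. For $T\in\mathcal{M}_n$ put $|T|=(T^*T)^{1/2}$ and $\mathcal{R}T=\frac12(T+T^*)$; write $A\le B$ if $B-A$ is positive semidefinite, $A\oplus B=\begin{bmatrix}A&O\\O&B\end{bmatrix}$, and let $s_1(A)\ge s_2(A)\ge\cdots$ be the singular values of $A$ in non-increasing order, counted with multiplicity. The matrix $T$ is called semi-hyponormal if $|T^*|\le|T|$. (1) If $T\in\mathcal{M}_n$ is semi-hyponormal, then for $j=1,2,\dots,n$ \[ s_j(T)\le s_j(|T|\oplus|T|)\quad\text{and}\quad s_j(\mathcal{R}T)\le s_j(|T|\oplus|T|). \] (2) For general matrices the arithmetic-geometric mean type inequality $s_j(\mathcal{R}T)\le\frac12 s_j(|T|\oplus|T^*|)$ fails: there are $n$, $T\in\mathcal{M}_n$ and $1\le j\le n$ for which it does not hold. The inequality $s_j(\mathcal{R}T)\le\frac12 s_j(|T|+|T^*|)$ fails as well: for $T=\begin{bmatrix}\mathrm{i}&\mathrm{i}\\0&0\end{bmatrix}$, \[ s_2(\mathcal{R}T)=\tfrac12>\tfrac{\sqrt2-1}{2}=\tfrac12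 s_2(|T|+|T^*|). \] -/

import Mathlib

open scoped MatrixOrder ComplexStarModule

/-- The singular values of a square complex matrix in non-increasing order, counted with
multiplicity. The index starts at `0`: `A.sval 0` is the largest one, usually written `s₁(A)`,
and `A.sval j` is usually written `s_{j+1}(A)`. -/
noncomputable def Matrix.sval {m : Type*} [Fintype m] [DecidableEq m]
    (A : Matrix m m ℂ) (j : ℕ) : ℝ :=
  (Matrix.toEuclideanLin A).singularValues j

/-- The direct sum `A ⊕ B`, that is, the block diagonal matrix with blocks `A` and `B`. -/
def Matrix.directSum {m k : Type*} (A : Matrix m m ℂ) (B : Matrix k k ℂ) :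
    Matrix (m ⊕ k) (m ⊕ k) ℂ :=
  Matrix.fromBlocks A 0 0 B

/-- `T` is semi-hyponormal if `|T*| ≤ |T|` in the Loewner order (`B - A` is positive
semidefinite), where `|T| = (T* T)^(1/2)`. -/
def Matrix.IsSemiHyponormal {m : Type*} [Fintype m] [DecidableEq m]
    (T : Matrix m m ℂ) : Prop :=
  CFC.abs T.conjTranspose ≤ CFC.abs T

/-! In finite dimension a semi-hyponormal matrix is normal: `|T|²` and `|T*|²` have equal traces, so
`|T*| ≤ |T|` forces `|T*| = |T|` (`eq_of_le_of_trace_mul_self_eq`). Hence `‖T* x‖ = ‖T x‖`, and the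
triangle inequality gives `‖(ℜ T) x‖ ≤ ‖T x‖ = ‖|T| x‖`. By Courant–Fischer, such pointwise norm
bounds pass to singular values, even along an isometric embedding
(`singularValues_le_of_norm_le_comp_isometry`); here it embeds the first summand of the direct sum.
The scalar `1` refutes the direct-sum inequality; the explicit 2 × 2 matrix is computed by hand. -/

open Module

namespace LinearMap

variable {𝕜 : Type*} [RCLike 𝕜]
  {E : Type*} [NormedAddCommGroup E] [InnerProductSpace 𝕜 E] [FiniteDimensional 𝕜 E]
  {F : Type*} [NormedAddCommGroup F] [InnerProductSpace 𝕜 F] [FiniteDimensional 𝕜 F]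
  {G : Type*} [NormedAddCommGroup G] [InnerProductSpace 𝕜 G] [FiniteDimensional 𝕜 G]
  {H : Type*} [NormedAddCommGroup H] [InnerProductSpace 𝕜 H] [FiniteDimensional 𝕜 H]

theorem norm_sq_apply_eq_sum_singularValues (A : E →ₗ[𝕜] F) (x : E) :
    ‖A x‖ ^ 2 = ∑ i : Fin (finrank 𝕜 E), A.singularValues i ^ 2 *
      ‖(A.isSymmetric_adjoint_comp_self.eigenvectorBasis rfl).repr x i‖ ^ 2 := by
  set b := A.isSymmetric_adjoint_comp_self.eigenvectorBasis rfl with hb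
  have h1 : ((‖A x‖ ^ 2 : ℝ) : 𝕜) = inner 𝕜 x ((adjoint A ∘ₗ A) x) := by
    rw [LinearMap.comp_apply, LinearMap.adjoint_inner_right, inner_self_eq_norm_sq_to_K]
    push_cast; rfl
  have h2 : inner 𝕜 x ((adjoint A ∘ₗ A) x) =
      ∑ i : Fin (finrank 𝕜 E), ((A.singularValues i ^ 2 * ‖b.repr x i‖ ^ 2 : ℝ) : 𝕜) := by
    rw [← b.repr.inner_map_map, PiLp.inner_apply]
    refine Finset.sum_congr rfl fun i _ ↦ ?_
    rw [hb, LinearMap.IsSymmetric.eigenvectorBasis_apply_self_apply, ← hb,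
      A.sq_singularValues_fin rfl, RCLike.inner_apply, mul_assoc, RCLike.mul_conj]
    push_cast; rfl
  rw [h2] at h1
  exact_mod_cast h1

/-- The witness is the span of the first `j + 1` eigenvectors of `A* A`; the next lemma uses the
orthogonal complement of the first `j`. -/
theorem exists_finrank_eq_forall_singularValues_mul_norm_le (A : E →ₗ[𝕜] F) {j : ℕ}
    (hj : j < finrank 𝕜 E) :
    ∃ W : Submodule 𝕜 E, finrank 𝕜 W = j + 1 ∧
      ∀ x ∈ W, A.singularValues j * ‖x‖ ≤ ‖A x‖ := by
  set b := A.isSymmetric_adjoint_comp_self.eigenvectorBasis rfl with hb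
  let e : Fin (j + 1) → Fin (finrank 𝕜 E) := Fin.castLE hj
  have he : Function.Injective e := Fin.castLE_injective hj
  refine ⟨Submodule.span 𝕜 (Set.range (b ∘ e)), ?_, fun x hx ↦ ?_⟩
  · rw [finrank_span_eq_card (b.orthonormal.linearIndependent.comp e he), Fintype.card_fin]
  have h0 : ∀ i : Fin (finrank 𝕜 E), j < i → b.repr x i = 0 := by
    intro i hi
    rw [b.repr_apply_apply]
    refine (Submodule.mem_orthogonal' (Submodule.span 𝕜 (Set.range (b ∘ e))) _).1 ?_ x hx
    rw [Submodule.mem_orthogonal']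
    intro u hu
    induction hu using Submodule.span_induction with
    | mem u hu =>
      obtain ⟨k, rfl⟩ := hu
      refine b.orthonormal.2 fun h ↦ ?_
      have := k.2
      simp [h, e] at hi
      omega
    | zero => simp
    | add u v _ _ hu hv => rw [inner_add_right, hu, hv, add_zero]
    | smul c u _ hu => rw [inner_smul_right, hu, mul_zero]
  refine le_of_sq_le_sq ?_ (norm_nonneg _)
  rw [mul_pow, A.norm_sq_apply_eq_sum_singularValues, ← b.repr.norm_map x,
    EuclideanSpace.norm_sq_eq, Finset.mul_sum]
  refine Finset.sum_le_sum fun i _ ↦ ?_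
  rcases lt_or_ge j i with hi | hi
  · rw [h0 i hi]; simp
  · have := A.singularValues_antitone hi
    have := A.singularValues_nonneg j
    gcongr

theorem exists_finrank_add_eq_forall_norm_le_singularValues_mul (A : E →ₗ[𝕜] F) {j : ℕ}
    (hj : j ≤ finrank 𝕜 E) :
    ∃ W : Submodule 𝕜 E, finrank 𝕜 W + j = finrank 𝕜 E ∧
      ∀ x ∈ W, ‖A x‖ ≤ A.singularValues j * ‖x‖ := by
  set b := A.isSymmetric_adjoint_comp_self.eigenvectorBasis rfl with hb
  let e : Fin j → Fin (finrank 𝕜 E) := Fin.castLE hj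
  have he : Function.Injective e := Fin.castLE_injective hj
  refine ⟨(Submodule.span 𝕜 (Set.range (b ∘ e)))ᗮ, ?_, fun x hx ↦ ?_⟩
  · have h := (Submodule.span 𝕜 (Set.range (b ∘ e))).finrank_add_finrank_orthogonal
    rwa [finrank_span_eq_card (b.orthonormal.linearIndependent.comp e he), Fintype.card_fin,
      add_comm] at h
  have h0 : ∀ i : Fin (finrank 𝕜 E), (i : ℕ) < j → b.repr x i = 0 := by
    intro i hi
    rw [b.repr_apply_apply]
    exact (Submodule.mem_orthogonal _ _).1 hx _ (Submodule.subset_span ⟨⟨i, hi⟩, rfl⟩)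
  refine le_of_sq_le_sq ?_ (mul_nonneg (A.singularValues_nonneg j) (norm_nonneg _))
  rw [mul_pow, A.norm_sq_apply_eq_sum_singularValues, ← b.repr.norm_map x,
    EuclideanSpace.norm_sq_eq, Finset.mul_sum]
  refine Finset.sum_le_sum fun i _ ↦ ?_
  rcases lt_or_ge (i : ℕ) j with hi | hi
  · rw [h0 i hi]; simp
  · have := A.singularValues_antitone hi
    have := A.singularValues_nonneg i
    gcongr

theorem exists_mem_inf_ne_zero {U W : Submodule 𝕜 E}
    (h : finrank 𝕜 E < finrank 𝕜 U + finrank 𝕜 W) : ∃ x ∈ U, x ∈ W ∧ x ≠ 0 := by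
  have h1 := Submodule.finrank_sup_add_finrank_inf_eq U W
  have h2 := (U ⊔ W).finrank_le
  have h3 : U ⊓ W ≠ ⊥ := by
    intro h3
    rw [h3, finrank_bot] at h1
    omega
  obtain ⟨x, hx, hx0⟩ := Submodule.exists_mem_ne_zero_of_ne_bot h3
  exact ⟨x, hx.1, hx.2, hx0⟩

/-- The lower half of the Courant–Fischer principle for singular values. -/
theorem le_singularValues_of_forall_mul_norm_le (A : E →ₗ[𝕜] F) {j : ℕ} {c : ℝ}
    (W : Submodule 𝕜 E) (hW : j < finrank 𝕜 W) (h : ∀ x ∈ W, c * ‖x‖ ≤ ‖A x‖) :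
    c ≤ A.singularValues j := by
  obtain ⟨U, hU, hAU⟩ := A.exists_finrank_add_eq_forall_norm_le_singularValues_mul
    (hW.le.trans W.finrank_le)
  obtain ⟨x, hxU, hxW, hx⟩ := exists_mem_inf_ne_zero (U := U) (W := W) (by omega)
  exact le_of_mul_le_mul_right ((h x hxW).trans (hAU x hxU)) (norm_pos_iff.2 hx)

/-- The upper half of the Courant–Fischer principle for singular values. -/
theorem singularValues_le_of_forall_norm_le (A : E →ₗ[𝕜] F) {j : ℕ} {c : ℝ} (hc : 0 ≤ c)
    (W : Submodule 𝕜 E) (hW : finrank 𝕜 E ≤ finrank 𝕜 W + j)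
    (h : ∀ x ∈ W, ‖A x‖ ≤ c * ‖x‖) : A.singularValues j ≤ c := by
  rcases le_or_gt (finrank 𝕜 E) j with hj | hj
  -- Singular values with index at least the dimension are `0` by convention.
  · rwa [A.singularValues_of_finrank_le hj]
  obtain ⟨U, hU, hAU⟩ := A.exists_finrank_eq_forall_singularValues_mul_norm_le hj
  obtain ⟨x, hxU, hxW, hx⟩ := exists_mem_inf_ne_zero (U := U) (W := W) (by omega)
  exact le_of_mul_le_mul_right ((hAU x hxU).trans (h x hxW)) (norm_pos_iff.2 hx)

theorem singularValues_le_of_norm_le_comp_isometry (A : E →ₗ[𝕜] F) (B : G →ₗ[𝕜] H)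
    (J : E →ₗᵢ[𝕜] G) (h : ∀ x, ‖A x‖ ≤ ‖B (J x)‖) (j : ℕ) :
    A.singularValues j ≤ B.singularValues j := by
  rcases le_or_gt (finrank 𝕜 E) j with hj | hj
  · rw [A.singularValues_of_finrank_le hj]
    exact B.singularValues_nonneg j
  obtain ⟨U, hU, hAU⟩ := A.exists_finrank_eq_forall_singularValues_mul_norm_le hj
  refine B.le_singularValues_of_forall_mul_norm_le (U.map J.toLinearMap) ?_ ?_
  · rw [← (Submodule.equivMapOfInjective J.toLinearMap J.injective U).finrank_eq, hU]
    exact j.lt_succ_self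
  · rintro _ ⟨x, hx, rfl⟩
    simpa using (hAU x hx).trans (h x)

end LinearMap

namespace Matrix

open scoped ComplexOrder

variable {m k : Type*} [Fintype m] [DecidableEq m] [Fintype k] [DecidableEq k]

theorem norm_sq_toEuclideanLin_apply (A : Matrix m m ℂ) (x : EuclideanSpace ℂ m) :
    ((‖toEuclideanLin A x‖ ^ 2 : ℝ) : ℂ) = inner ℂ x (toEuclideanLin (Aᴴ * A) x) := by
  have h : toEuclideanLin (Aᴴ * A) x = toEuclideanLin Aᴴ (toEuclideanLin A x) := by
    simp [toLpLin_apply]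
  rw [h, toEuclideanLin_conjTranspose_eq_adjoint, LinearMap.adjoint_inner_right,
    inner_self_eq_norm_sq_to_K]
  push_cast; rfl

theorem norm_toEuclideanLin_apply_eq_of_conjTranspose_mul_self_eq {A B : Matrix m m ℂ}
    (h : Aᴴ * A = Bᴴ * B) (x : EuclideanSpace ℂ m) :
    ‖toEuclideanLin A x‖ = ‖toEuclideanLin B x‖ := by
  have h1 := norm_sq_toEuclideanLin_apply A x
  rw [h, ← norm_sq_toEuclideanLin_apply B x] at h1
  exact (sq_eq_sq₀ (norm_nonneg _) (norm_nonneg _)).1 (by exact_mod_cast h1)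

theorem norm_toEuclideanLin_abs_apply (T : Matrix m m ℂ) (x : EuclideanSpace ℂ m) :
    ‖toEuclideanLin (CFC.abs T) x‖ = ‖toEuclideanLin T x‖ := by
  refine norm_toEuclideanLin_apply_eq_of_conjTranspose_mul_self_eq ?_ x
  have h : (CFC.abs T)ᴴ = CFC.abs T := (nonneg_iff_posSemidef.1 (CFC.abs_nonneg T)).isHermitian
  rw [h, CFC.abs_mul_abs, star_eq_conjTranspose]

/-- The inclusion of the first summand of `m ⊕ k` on Euclidean spaces. -/
noncomputable def euclideanInl (m k : Type*) [Fintype m] [Fintype k] :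
    EuclideanSpace ℂ m →ₗᵢ[ℂ] EuclideanSpace ℂ (m ⊕ k) where
  toFun x := WithLp.toLp 2 (Sum.elim x 0)
  map_add' x y := by ext (i | i) <;> simp
  map_smul' c x := by ext (i | i) <;> simp
  norm_map' x := by simp [EuclideanSpace.norm_eq]

theorem toEuclideanLin_directSum_euclideanInl (A : Matrix m m ℂ) (B : Matrix k k ℂ)
    (x : EuclideanSpace ℂ m) :
    toEuclideanLin (A.directSum B) (euclideanInl m k x) = euclideanInl m k (toEuclideanLin A x) := by
  ext (i | i) <;> simp [euclideanInl, directSum, toLpLin_apply, fromBlocks_mulVec]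

theorem sval_le_sval_directSum_of_norm_le (A B : Matrix m m ℂ) (C : Matrix k k ℂ)
    (h : ∀ x, ‖toEuclideanLin A x‖ ≤ ‖toEuclideanLin B x‖) (j : ℕ) :
    A.sval j ≤ (B.directSum C).sval j := by
  refine LinearMap.singularValues_le_of_norm_le_comp_isometry _ _ (euclideanInl m k) (fun x ↦ ?_) j
  rw [toEuclideanLin_directSum_euclideanInl, LinearIsometry.norm_map]
  exact h x

theorem trace_mul_nonneg_of_posSemidef {A B : Matrix m m ℂ} (hA : A.PosSemidef)
    (hB : B.PosSemidef) : 0 ≤ (A * B).trace := by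
  obtain ⟨C, rfl⟩ := CStarAlgebra.nonneg_iff_eq_star_mul_self.1 (nonneg_iff_posSemidef.2 hB)
  rw [star_eq_conjTranspose, ← mul_assoc, trace_mul_comm, ← mul_assoc]
  exact (hA.mul_mul_conjTranspose_same C).trace_nonneg

/-- With `D = A - B`, `tr A² - tr B² = tr D² + 2 tr (D B)`. Both terms are nonnegative, so `tr D² =
0`, and `D` is Hermitian. -/
theorem eq_of_le_of_trace_mul_self_eq {A B : Matrix m m ℂ} (hB : 0 ≤ B) (hBA : B ≤ A)
    (h : (A * A).trace = (B * B).trace) : A = B := by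
  have hD : (A - B).PosSemidef := le_iff.1 hBA
  have h1 := trace_mul_nonneg_of_posSemidef hD (nonneg_iff_posSemidef.1 hB)
  have h2 := trace_mul_nonneg_of_posSemidef hD hD
  have h3 : ((A - B) * (A - B)).trace + (((A - B) * B).trace + ((A - B) * B).trace) = 0 := by
    have h4 := trace_mul_comm A B
    simp only [sub_mul, mul_sub, trace_sub]
    linear_combination h + h4
  have h5 : ((A - B) * (A - B)).trace = 0 := by
    exact le_antisymm ((le_add_of_nonneg_right (add_nonneg h1 h1)).trans_eq h3) h2
  nth_rewrite 1 [← hD.isHermitian] at h5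
  exact sub_eq_zero.1 (trace_conjTranspose_mul_self_eq_zero_iff.1 h5)

/-- A semi-hyponormal matrix is normal. -/
theorem IsSemiHyponormal.mul_conjTranspose_eq {T : Matrix m m ℂ} (hT : T.IsSemiHyponormal) :
    T * Tᴴ = Tᴴ * T := by
  have h1 : CFC.abs T * CFC.abs T = Tᴴ * T := CFC.abs_mul_abs T
  have h2 : CFC.abs Tᴴ * CFC.abs Tᴴ = T * Tᴴ := by
    rw [CFC.abs_mul_abs, star_eq_conjTranspose, conjTranspose_conjTranspose]
  have h3 : (CFC.abs T * CFC.abs T).trace = (CFC.abs Tᴴ * CFC.abs Tᴴ).trace := by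
    rw [h1, h2, trace_mul_comm]
  have h4 : CFC.abs T = CFC.abs Tᴴ :=
    eq_of_le_of_trace_mul_self_eq (CFC.abs_nonneg Tᴴ) hT h3
  rw [← h1, ← h2, h4]

theorem IsSemiHyponormal.norm_toEuclideanLin_realPart_apply_le {T : Matrix m m ℂ}
    (hT : T.IsSemiHyponormal) (x : EuclideanSpace ℂ m) :
    ‖toEuclideanLin (ℜ T : Matrix m m ℂ) x‖ ≤ ‖toEuclideanLin T x‖ := by
  have h : ‖toEuclideanLin Tᴴ x‖ = ‖toEuclideanLin T x‖ := by
    refine norm_toEuclideanLin_apply_eq_of_conjTranspose_mul_self_eq ?_ x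
    rw [conjTranspose_conjTranspose, hT.mul_conjTranspose_eq]
  have h1 : toEuclideanLin (ℜ T : Matrix m m ℂ) x =
      (2⁻¹ : ℝ) • (toEuclideanLin T x + toEuclideanLin Tᴴ x) := by
    rw [realPart_apply_coe, star_eq_conjTranspose]
    ext i
    simp [toLpLin_apply, smul_mulVec]
  rw [h1, norm_smul]
  have h2 := norm_add_le (toEuclideanLin T x) (toEuclideanLin Tᴴ x)
  rw [h] at h2
  norm_num
  linarith

theorem sval_eq_of_forall_norm_eq {A : Matrix m m ℂ} {c : ℝ} (hc : 0 ≤ c)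
    (h : ∀ x, ‖toEuclideanLin A x‖ = c * ‖x‖) {j : ℕ} (hj : j < Fintype.card m) :
    A.sval j = c := by
  refine le_antisymm ?_ ?_
  · exact LinearMap.singularValues_le_of_forall_norm_le _ hc ⊤ (by simp) fun x _ ↦ (h x).le
  · exact LinearMap.le_singularValues_of_forall_mul_norm_le _ ⊤ (by simpa) fun x _ ↦ (h x).ge

/-- The hypothesis makes `T* T` twice a projection, so its positive square root is `T* T / √2`. -/
theorem abs_eq_smul_of_mul_self_eq {T : Matrix m m ℂ}
    (h : (Tᴴ * T) * (Tᴴ * T) = 2 • (Tᴴ * T)) :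
    CFC.abs T = ((√2 / 2 : ℝ) : ℂ) • (Tᴴ * T) := by
  refine CFC.sqrt_unique ?_ ?_
  · rw [smul_mul_smul_comm, h, ← Nat.cast_smul_eq_nsmul ℂ, smul_smul, ← Complex.ofReal_mul,
      div_mul_div_comm, Real.mul_self_sqrt zero_le_two]
    norm_num [star_eq_conjTranspose]
  · refine nonneg_iff_posSemidef.2 ((posSemidef_conjTranspose_mul_self T).smul ?_)
    exact Complex.zero_le_real.2 (by positivity)

/-- This real part is half of a unitary matrix. -/
theorem sval_one_realPart_example :
    (ℜ !![Complex.I, Complex.I; 0, 0] : Matrix (Fin 2) (Fin 2) ℂ).sval 1 = 1 / 2 := by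
  refine sval_eq_of_forall_norm_eq (by norm_num) (fun x ↦ ?_) (by simp)
  refine (sq_eq_sq₀ (norm_nonneg _) (by positivity)).1 ?_
  rw [mul_pow, EuclideanSpace.norm_sq_eq, EuclideanSpace.norm_sq_eq]
  simp [realPart_apply_coe, star_eq_conjTranspose, toLpLin_apply, Fin.sum_univ_two, dotProduct]
  ring

theorem abs_add_abs_conjTranspose_example :
    CFC.abs (!![Complex.I, Complex.I; 0, 0] : Matrix (Fin 2) (Fin 2) ℂ) +
      CFC.abs (!![Complex.I, Complex.I; 0, 0] : Matrix (Fin 2) (Fin 2) ℂ)ᴴ =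
      ((√2 / 2 : ℝ) : ℂ) • !![3, 1; 1, 1] := by
  have h : (!![Complex.I, Complex.I; 0, 0] : Matrix (Fin 2) (Fin 2) ℂ)ᴴ =
      !![-Complex.I, 0; -Complex.I, 0] := by
    ext i j
    fin_cases i <;> fin_cases j <;> simp
  have h' : (!![-Complex.I, 0; -Complex.I, 0] : Matrix (Fin 2) (Fin 2) ℂ)ᴴ =
      !![Complex.I, Complex.I; 0, 0] := by
    rw [← h, conjTranspose_conjTranspose]
  rw [h, abs_eq_smul_of_mul_self_eq, abs_eq_smul_of_mul_self_eq, ← smul_add, h, h']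
  · congr 1
    ext i j
    fin_cases i <;> fin_cases j <;> norm_num
  · rw [h']
    ext i j
    fin_cases i <;> fin_cases j <;> norm_num
  · rw [h]
    ext i j
    fin_cases i <;> fin_cases j <;> norm_num

/-- The matrix has eigenvalues `√2 ± 1`. Subtracting `(√2 - 1)²` from its square leaves a rank-one
form along the top eigenvector `(1, √2 - 1)`. -/
theorem norm_sq_toEuclideanLin_example_apply (x : EuclideanSpace ℂ (Fin 2)) :
    ‖toEuclideanLin (((√2 / 2 : ℝ) : ℂ) • !![3, 1; 1, 1]) x‖ ^ 2 =
      (√2 - 1) ^ 2 * ‖x‖ ^ 2 + (2 + 2 * √2) * ‖x 0 + ((√2 - 1 : ℝ) : ℂ) * x 1‖ ^ 2 := by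
  have h2 : √2 ^ 2 = 2 := Real.sq_sqrt zero_le_two
  rw [EuclideanSpace.norm_sq_eq, EuclideanSpace.norm_sq_eq]
  simp only [Fin.sum_univ_two, toLpLin_apply, smul_mulVec,
    Complex.sq_norm, Complex.normSq_apply]
  simp [vecHead, vecTail]
  linear_combination (3 / 2 * ((x 0).re ^ 2 + (x 0).im ^ 2) -
    2 * ((x 0).re * (x 1).re + (x 0).im * (x 1).im) +
    (3 / 2 - 2 * √2) * ((x 1).re ^ 2 + (x 1).im ^ 2)) * h2

theorem sval_one_example :
    (((√2 / 2 : ℝ) : ℂ) • (!![3, 1; 1, 1] : Matrix (Fin 2) (Fin 2) ℂ)).sval 1 = √2 - 1 := by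
  have h1 : 0 ≤ √2 - 1 := sub_nonneg.2 (Real.one_le_sqrt.2 one_le_two)
  refine le_antisymm ?_ ?_
  · refine LinearMap.singularValues_le_of_forall_norm_le _ h1
      -- This eigenvector for `√2 - 1` annihilates the rank-one term.
      (Submodule.span ℂ {WithLp.toLp 2 ![((√2 - 1 : ℝ) : ℂ), -1]}) ?_ fun x hx ↦ ?_
    · rw [finrank_span_singleton]
      · simp
      · intro h
        simpa using congrArg (fun v : EuclideanSpace ℂ (Fin 2) ↦ v 1) h
    · obtain ⟨c, rfl⟩ := Submodule.mem_span_singleton.1 hx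
      refine le_of_sq_le_sq ?_ (by positivity)
      rw [norm_sq_toEuclideanLin_example_apply, mul_pow]
      simp [mul_comm]
  · refine LinearMap.le_singularValues_of_forall_mul_norm_le _ ⊤ (by simp) fun x _ ↦ ?_
    refine le_of_sq_le_sq ?_ (norm_nonneg _)
    rw [norm_sq_toEuclideanLin_example_apply, mul_pow]
    exact le_add_of_nonneg_right (by positivity)

theorem sval_one {j : ℕ} (hj : j < Fintype.card m) : (1 : Matrix m m ℂ).sval j = 1 :=
  sval_eq_of_forall_norm_eq zero_le_one (fun x ↦ by simp) hj

end Matrix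

theorem mainTheorem10 :
    -- the singular value inequalities for semi-hyponormal matrices
    (∀ (n : ℕ) (T : Matrix (Fin n) (Fin n) ℂ), T.IsSemiHyponormal → ∀ j : Fin n,
      T.sval j ≤ ((CFC.abs T).directSum (CFC.abs T)).sval j ∧
      (ℜ T : Matrix (Fin n) (Fin n) ℂ).sval j ≤ ((CFC.abs T).directSum (CFC.abs T)).sval j) ∧
    -- the arithmetic-geometric mean inequality with a direct sum fails for general matrices
    (¬ ∀ (n : ℕ) (T : Matrix (Fin n) (Fin n) ℂ) (j : Fin n),
      (ℜ T : Matrix (Fin n) (Fin n) ℂ).sval j ≤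
        (1 / 2 : ℝ) * ((CFC.abs T).directSum (CFC.abs T.conjTranspose)).sval j) ∧
    -- the one with an ordinary sum fails as well, for an explicit matrix and its second
    -- singular value
    (∀ T : Matrix (Fin 2) (Fin 2) ℂ, T = !![Complex.I, Complex.I; 0, 0] →
      (ℜ T : Matrix (Fin 2) (Fin 2) ℂ).sval 1 = 1 / 2 ∧
      (1 / 2 : ℝ) * (CFC.abs T + CFC.abs T.conjTranspose).sval 1 = (Real.sqrt 2 - 1) / 2 ∧
      (1 / 2 : ℝ) * (CFC.abs T + CFC.abs T.conjTranspose).sval 1 <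
        (ℜ T : Matrix (Fin 2) (Fin 2) ℂ).sval 1) := by
  refine ⟨fun n T hT j ↦ ⟨?_, ?_⟩, fun h ↦ ?_, ?_⟩
  · exact Matrix.sval_le_sval_directSum_of_norm_le _ _ _
      (fun x ↦ (Matrix.norm_toEuclideanLin_abs_apply T x).ge) j
  · exact Matrix.sval_le_sval_directSum_of_norm_le _ _ _
      (fun x ↦ (hT.norm_toEuclideanLin_realPart_apply_le x).trans
        (Matrix.norm_toEuclideanLin_abs_apply T x).ge) j
  -- For `n = 1` and `T = 1` the inequality would read `1 ≤ 1 / 2`.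
  · have h1 := h 1 1 0
    rw [Matrix.conjTranspose_one, CFC.abs_one, Matrix.directSum, Matrix.fromBlocks_one,
      (IsSelfAdjoint.one _).coe_realPart, Matrix.sval_one (by simp),
      Matrix.sval_one (by simp)] at h1
    norm_num at h1
  · rintro T rfl
    rw [Matrix.abs_add_abs_conjTranspose_example, Matrix.sval_one_example,
      Matrix.sval_one_realPart_example]
    have h : √2 < 2 := by
      rw [Real.sqrt_lt' two_pos]
      norm_num
    refine ⟨rfl, by ring, ?_⟩
    linarith
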